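/- Let $d\ge 1$. A subcube of $\{0,1\}^d$ is a set of points obtained by fixing the values of some (possibly none, possibly all) of the coordinates and letting the others vary freely. Let $\mathcal I(n,d)$ be the set of graphs on $n$ vertices that are intersection graphs of $n$ subcubes $A_1,\dots,A_n$ of $\{0,1\}^d$ (repetitions allowed; distinct vertices $i,j$ are adjacent if and only if $A_i\cap A_j\neq\emptyset$). For $k,l\ge 1$ put $$R_d(k,l)=\min\{n:\ \text{every } G\in\mathcal I(n,d)\text{ contains a clique on } k \text{ vertices or an independent set of } l \text{ vertices}\}.$$ Theorem. (i) For every integer $l\ge 3$ there is a constant $c_l>0$, depending only on $l$, such that for all integers $d\ge 2$ and $k\ge 1$ $$d\left\lfloor\frac{k}{c_l\,d^{2/(l+1)}\log_2 d}\right\rfloor<R_d(k,l).$$ (ii) For all integers $l\ge 2$, $d\ge 1$ and $k\ge 1$ $$R_d(k,l)<2d^{\,l-2}k.$$ -/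

import Mathlib

/-- `C_d = {0,1,*}^d`; `none` plays the role of `*` (a free coordinate). -/
abbrev SubcubeCode (d : ℕ) : Type := Fin d → Option Bool

/-- The subcube of `{0,1}^d` represented by `u ∈ {0,1,*}^d`: all points that agree with `u` at every
coordinate fixed by `u`. -/
def SubcubeCode.points {d : ℕ} (u : SubcubeCode d) : Set (Fin d → Bool) :=
  {x | ∀ i, u i ≠ none → u i = some (x i)}

/-- The intersection graph of a family `A` of subcubes of `{0,1}^d` (repetitions are allowed): two
different indices are adjacent iff the corresponding subcubes intersect. -/
def subcubeIntersectionGraph {ι : Type*} {d : ℕ} (A : ι → SubcubeCode d) : SimpleGraph ι where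
  Adj i j := i ≠ j ∧ ((A i).points ∩ (A j).points).Nonempty
  symm := ⟨fun _ _ h => ⟨h.1.symm, by rw [Set.inter_comm]; exact h.2⟩⟩
  loopless := ⟨fun _ h => h.1 rfl⟩

/-- `I(n,d)`: the graphs on `n` vertices that are intersection graphs of `n` subcubes of
`{0,1}^d`. -/
def subcubeGraphs (n d : ℕ) : Set (SimpleGraph (Fin n)) :=
  {G | ∃ A : Fin n → SubcubeCode d, G = subcubeIntersectionGraph A}

/-- The numbers `n` such that every graph in `I(n,d)` contains a clique on `k` vertices or an
independent set of `l` vertices. -/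
def subcubeRamseySet (d k l : ℕ) : Set ℕ :=
  {n | ∀ G ∈ subcubeGraphs n d,
    (∃ s : Finset (Fin n), G.IsNClique k s) ∨ (∃ s : Finset (Fin n), G.IsNIndepSet l s)}

/-- `R_d(k,l)`: the least element of `subcubeRamseySet d k l`
(which exists, see `isLeast_subcubeRamsey`). -/
noncomputable def subcubeRamsey (d k l : ℕ) : ℕ := sInf (subcubeRamseySet d k l)

theorem subcubeRamseySet_nonempty (d k l : ℕ) : (subcubeRamseySet d k l).Nonempty := by
  classical
  refine ⟨2 ^ d * k, ?_⟩
  rintro G ⟨A, rfl⟩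
  left
  let f : Fin (2 ^ d * k) → (Fin d → Bool) := fun i c => (A i c).getD false
  have hf : ∀ i, f i ∈ (A i).points := by
    intro i c hc
    obtain ⟨b, hb⟩ := Option.ne_none_iff_exists'.mp hc
    simp [f, hb]
  obtain ⟨y, -, hy⟩ := Finset.exists_le_card_fiber_of_mul_le_card_of_maps_to
    (s := (Finset.univ : Finset (Fin (2 ^ d * k)))) (t := (Finset.univ : Finset (Fin d → Bool)))
    (f := f) (n := k) (fun _ _ => Finset.mem_univ _) Finset.univ_nonempty (by simp)
  obtain ⟨s, hs, hcard⟩ := Finset.exists_subset_card_eq hy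
  refine ⟨s, ⟨?_, hcard⟩⟩
  intro i hi j hj hij
  have h1 := (Finset.mem_filter.mp (hs hi)).2
  have h2 := (Finset.mem_filter.mp (hs hj)).2
  exact ⟨hij, y, h1 ▸ hf i, h2 ▸ hf j⟩

theorem isLeast_subcubeRamsey (d k l : ℕ) :
    IsLeast (subcubeRamseySet d k l) (subcubeRamsey d k l) :=
  ⟨Nat.sInf_mem (subcubeRamseySet_nonempty d k l), fun _ h => Nat.sInf_le h⟩

/-! Upper bound: let `x` take at each coordinate the value fixed by most members. The subcubes
through `x` form a clique, so there are fewer than `k` of them. Any other one fixes the value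
opposite to `x` at some coordinate `i`. If the class of those at `i` is nonempty, the majority
choice supplies a member fixing `x i`, which is disjoint from the whole class. So independent sets
in the class are shorter by one, and induction (`card_le_geom`) bounds the family by `k - 1` times a
geometric sum in `d`.

Lower bound: every graph `H` on `d` vertices is the disjointness graph of `d` subcubes of `{0,1}^d`
(`graphCode`). Repeating each subcube `q` times turns a graph without `l`-cliques and independent
`t`-sets into a family of `d * q` subcubes with no independent `l`-set and no clique of `t * q`
members (for `q > 0`). The local lemma, applied to a random graph of density `1 / N` with `N` of
order `d^(2/(l+1))`, gives such an `H` with `t` of order `N log d`. -/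

/-! ### The upper bound: majority points and induction -/

theorem mem_points_of_forall_ne {d : ℕ} (u : SubcubeCode d) (x : Fin d → Bool)
    (h : ∀ i, u i ≠ some (!x i)) : x ∈ u.points := by
  intro i hi
  obtain ⟨b, hb⟩ := Option.ne_none_iff_exists'.mp hi
  have := h i
  rw [hb] at this ⊢
  cases b <;> cases hx : x i <;> simp_all

theorem points_inter_eq_empty {d : ℕ} {u v : SubcubeCode d} {i : Fin d} {b : Bool}
    (hu : u i = some b) (hv : v i = some (!b)) : ¬ (u.points ∩ v.points).Nonempty := by
  rintro ⟨x, h1, h2⟩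
  have h1 := h1 i (by simp [hu])
  have h2 := h2 i (by simp [hv])
  rw [hu] at h1
  rw [hv] at h2
  cases b <;> simp_all

/-- A set of indices all of whose subcubes contain a common point is a clique. -/
theorem isClique_of_common_point {ι : Type*} {d : ℕ} {A : ι → SubcubeCode d} {s : Set ι}
    (x : Fin d → Bool) (h : ∀ i ∈ s, x ∈ (A i).points) :
    (subcubeIntersectionGraph A).IsClique s :=
  fun i hi j hj hij => ⟨hij, x, h i hi, h j hj⟩

theorem card_lt_of_isClique {ι : Type*} {G : SimpleGraph ι} {k : ℕ}
    (hk : ∀ s : Finset ι, ¬ G.IsNClique k s) {s : Finset ι} (hs : G.IsClique (s : Set ι)) :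
    s.card < k := by
  by_contra! h
  obtain ⟨t, ht, hc⟩ := Finset.exists_subset_card_eq h
  exact hk t ⟨hs.subset (by exact_mod_cast ht), hc⟩

/-- The point which at every coordinate takes the value fixed by most members of the family. -/
theorem exists_majority_point {ι : Type*} {d : ℕ} (A : ι → SubcubeCode d) (S : Finset ι) :
    ∃ x : Fin d → Bool, ∀ i, (S.filter fun j => A j i = some (!x i)).card ≤
      (S.filter fun j => A j i = some (x i)).card := by
  have (i : Fin d) : ∃ b : Bool, (S.filter fun j => A j i = some (!b)).card ≤
      (S.filter fun j => A j i = some b).card := by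
    rcases le_total (S.filter fun j => A j i = some false).card
      (S.filter fun j => A j i = some true).card with h | h
    · exact ⟨true, by simpa using h⟩
    · exact ⟨false, by simpa using h⟩
  choose x hx using this
  exact ⟨x, hx⟩

theorem card_le_of_point {ι : Type*} {d k : ℕ} {A : ι → SubcubeCode d}
    (hk : ∀ s : Finset ι, ¬ (subcubeIntersectionGraph A).IsNClique k s) (S : Finset ι)
    (x : Fin d → Bool) :
    S.card < k + ∑ i, (S.filter fun j => A j i = some (!x i)).card := by
  classical
  have h1 : (S.filter fun j => ∀ i, A j i ≠ some (!x i)).card < k :=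
    card_lt_of_isClique hk (isClique_of_common_point x fun j hj =>
      mem_points_of_forall_ne _ _ (by simpa using (Finset.mem_filter.mp hj).2))
  have h2 : S ⊆ (S.filter fun j => ∀ i, A j i ≠ some (!x i)) ∪
      Finset.univ.biUnion fun i => S.filter fun j => A j i = some (!x i) := by
    intro j hj
    by_cases h : ∀ i, A j i ≠ some (!x i)
    · exact Finset.mem_union_left _ (Finset.mem_filter.mpr ⟨hj, h⟩)
    · push Not at h
      obtain ⟨i, hi⟩ := h
      exact Finset.mem_union_right _ (Finset.mem_biUnion.mpr
        ⟨i, Finset.mem_univ _, Finset.mem_filter.mpr ⟨hj, hi⟩⟩)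
  have h3 := (Finset.card_le_card h2).trans (Finset.card_union_le _ _)
  have h4 := Finset.card_biUnion_le (s := (Finset.univ : Finset (Fin d)))
    (t := fun i => S.filter fun j => A j i = some (!x i))
  omega

theorem isIndepSet_insert {ι : Type*} [DecidableEq ι] {G : SimpleGraph ι} {s : Finset ι} {v : ι}
    {a : ℕ} (hs : G.IsNIndepSet a s) (hv : ∀ w ∈ s, v ≠ w ∧ ¬ G.Adj v w) :
    G.IsNIndepSet (a + 1) (insert v s) := by
  have hvs : v ∉ s := fun h => (hv v h).1 rfl
  refine ⟨?_, by rw [Finset.card_insert_of_notMem hvs, hs.2]⟩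
  rw [SimpleGraph.isIndepSet_iff, Finset.coe_insert, Set.pairwise_insert]
  exact ⟨hs.1, fun w hw _ => ⟨(hv w hw).2, fun h => (hv w hw).2 h.symm⟩⟩

/-- With `f a` the bound, the majority point gives `f (a + 1) = (k - 1) + d * f a`: one clique plus
`d` opposing classes, each of which could be extended by a disjoint majority member `v`. -/
theorem card_le_geom {ι : Type*} {d k : ℕ} {A : ι → SubcubeCode d} (hk1 : 1 ≤ k)
    (hk : ∀ s : Finset ι, ¬ (subcubeIntersectionGraph A).IsNClique k s) (a : ℕ) (S : Finset ι)
    (hS : ∀ s ⊆ S, ¬ (subcubeIntersectionGraph A).IsNIndepSet (a + 1) s) :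
    S.card ≤ (k - 1) * ∑ i ∈ Finset.range a, d ^ i := by
  classical
  induction a generalizing S with
  | zero =>
    rcases S.eq_empty_or_nonempty with rfl | ⟨v, hv⟩
    · simp
    · exact absurd ⟨by simp, by simp⟩ (hS {v} (by simpa using hv))
  | succ a ih =>
    obtain ⟨x, hx⟩ := exists_majority_point A S
    have h1 := card_le_of_point hk S x
    have h2 (i : Fin d) : (S.filter fun j => A j i = some (!x i)).card ≤
        (k - 1) * ∑ i ∈ Finset.range a, d ^ i := by
      rcases (S.filter fun j => A j i = some (!x i)).eq_empty_or_nonempty with h0 | h0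
      · simp [h0]
      obtain ⟨v, hv⟩ := Finset.card_pos.mp ((Finset.card_pos.mpr h0).trans_le (hx i))
      refine ih _ fun s hs hind => ?_
      refine hS (insert v s) ?_ (isIndepSet_insert hind fun w hw => ?_)
      · exact Finset.insert_subset (Finset.mem_filter.mp hv).1
          (hs.trans (Finset.filter_subset _ _))
      · have hv' := (Finset.mem_filter.mp hv).2
        have hw' := (Finset.mem_filter.mp (hs hw)).2
        refine ⟨?_, fun h => points_inter_eq_empty hv' hw' h.2⟩
        rintro rfl
        rw [hv'] at hw'
        simp at hw'
    have h3 : ∑ i : Fin d, (S.filter fun j => A j i = some (!x i)).card ≤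
        d * ((k - 1) * ∑ i ∈ Finset.range a, d ^ i) := by
      simpa using Finset.sum_le_card_nsmul Finset.univ _ _ fun i _ => h2 i
    rw [geom_sum_succ]
    have : (k - 1) * (d * ∑ i ∈ Finset.range a, d ^ i + 1) =
      d * ((k - 1) * ∑ i ∈ Finset.range a, d ^ i) + (k - 1) := by ring
    omega

theorem geom_sum_lt_two_mul_pow {d : ℕ} (hd : 2 ≤ d) (a : ℕ) :
    ∑ i ∈ Finset.range (a + 1), d ^ i < 2 * d ^ a := by
  rw [Finset.sum_range_succ]
  have := Nat.geomSum_lt hd (s := Finset.range a) (n := a) (by simp)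
  omega

theorem subcubeRamsey_upper {l d k : ℕ} (hl : 2 ≤ l) (hd : 1 ≤ d) (hk : 1 ≤ k) :
    subcubeRamsey d k l < 2 * d ^ (l - 2) * k := by
  have hpos : 1 ≤ d ^ (l - 2) := Nat.one_le_pow _ _ hd
  have hpos' : 1 ≤ d ^ (l - 2) * k := Nat.mul_pos hpos hk
  suffices 2 * d ^ (l - 2) * k - 1 ∈ subcubeRamseySet d k l by
    have := Nat.sInf_le this
    rw [subcubeRamsey]
    rw [mul_assoc] at *
    omega
  rintro G ⟨A, rfl⟩
  by_contra! h
  obtain ⟨h1, h2⟩ := h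
  obtain ⟨a, rfl⟩ := Nat.exists_eq_add_of_le' hl
  simp only [Nat.add_sub_cancel] at *
  suffices Fintype.card (Fin (2 * d ^ a * k - 1)) ≤ 2 * d ^ a * k - 2 by
    rw [Fintype.card_fin, mul_assoc] at this
    omega
  rw [← Finset.card_univ]
  -- For `d = 1` the geometric sum grows with `l`, so this case is separate: the subcubes through
  -- each of the two points form a clique, leaving at most `2 * (k - 1)` in all.
  rcases hd.eq_or_lt with rfl | hd
  · obtain ⟨x, hx⟩ := exists_majority_point A Finset.univ
    have h3 := card_le_of_point h1 Finset.univ x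
    have h4 := card_lt_of_isClique h1 (s := Finset.univ.filter fun j => A j 0 = some (!x 0))
      (isClique_of_common_point (fun i => !x i) fun j hj => by
        refine mem_points_of_forall_ne _ _ fun i => ?_
        rw [Subsingleton.elim i 0, (Finset.mem_filter.mp hj).2]
        simp)
    simp only [Finset.univ_unique, Fin.default_eq_zero, Finset.sum_singleton, one_pow] at *
    omega
  · have h3 := card_le_geom hk h1 (a + 1) Finset.univ fun s _ => h2 s
    have h4 := geom_sum_lt_two_mul_pow hd a
    refine h3.trans ?_
    calc _ ≤ (k - 1) * (2 * d ^ a) := Nat.mul_le_mul_left _ h4.le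
      _ = 2 * d ^ a * k - 2 * d ^ a := by rw [Nat.sub_mul, mul_comm, one_mul]
      _ ≤ _ := by omega

/-! ### The Lovász local lemma by counting -/

/-- The outcomes that avoid all the events `A j`, `j ∈ S`. -/
def avoid {ι Ω : Type*} [Fintype Ω] [DecidableEq Ω] (A : ι → Finset Ω) (S : Finset ι) : Finset Ω :=
  Finset.univ.filter fun ω => ∀ j ∈ S, ω ∉ A j

theorem card_avoid_insert {ι Ω : Type*} [DecidableEq ι] [Fintype Ω] [DecidableEq Ω]
    (A : ι → Finset Ω) (S : Finset ι) (i : ι) :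
    ((avoid A (insert i S)).card : ℝ) = (avoid A S).card - (avoid A S ∩ A i).card := by
  have h : avoid A (insert i S) = avoid A S \ A i := by
    ext ω
    simp only [avoid, Finset.mem_filter, Finset.mem_univ, true_and, Finset.mem_insert,
      Finset.mem_sdiff, forall_eq_or_imp]
    tauto
  rw [h, eq_sub_iff_add_eq]
  exact_mod_cast Finset.card_sdiff_add_card_inter _ _

theorem avoid_anti {ι Ω : Type*} [Fintype Ω] [DecidableEq Ω] (A : ι → Finset Ω) {S T : Finset ι}
    (h : S ⊆ T) : avoid A T ⊆ avoid A S := by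
  intro ω hω
  simp only [avoid, Finset.mem_filter, Finset.mem_univ, true_and] at *
  exact fun j hj => hω j (h hj)

section LocalLemma

variable {ι Ω : Type*} [DecidableEq ι] [Fintype Ω] [DecidableEq Ω] {A : ι → Finset Ω}
  {x q : ι → ℝ} {adj : ι → ι → Prop} [DecidableRel adj] {I : Finset ι}

/-- The conditional probability of `A i` given that `S` is avoided is at most `x i`, stated without
division. Split `S` into neighbours `S₁` and non-neighbours `S₂` of `i`: independence handles `S₂`,
and adding `S₁` one event at a time costs a factor `1 - x j` each, by induction on smaller sets. -/
theorem card_avoid_inter_le (hx0 : ∀ i ∈ I, 0 ≤ x i) (hx1 : ∀ i ∈ I, x i < 1)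
    (hind : ∀ i ∈ I, ∀ S ⊆ I, (∀ j ∈ S, ¬ adj i j) →
      ((avoid A S ∩ A i).card : ℝ) ≤ q i * (avoid A S).card)
    (hq : ∀ i ∈ I, q i ≤ x i * ∏ j ∈ I with adj i j, (1 - x j)) (S : Finset ι) (hS : S ⊆ I)
    (i : ι) (hi : i ∈ I) :
    ((avoid A S ∩ A i).card : ℝ) ≤ x i * (avoid A S).card := by
  induction S using Finset.strongInduction generalizing i with
  | H S ih =>
    set S₁ := S.filter fun j => adj i j with hS₁
    set S₂ := S.filter fun j => ¬ adj i j with hS₂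
    have key (T : Finset ι) (hT : T ⊆ S₁) :
        (∏ j ∈ T, (1 - x j)) * (avoid A S₂).card ≤ ((avoid A (T ∪ S₂)).card : ℝ) := by
      induction T using Finset.induction_on with
      | empty => simp
      | insert j T hj ihT =>
        have hT' : T ⊆ S₁ := (Finset.subset_insert j T).trans hT
        have hjS₁ : j ∈ S₁ := hT (Finset.mem_insert_self _ _)
        have hjS : j ∈ S := (Finset.mem_filter.mp hjS₁).1
        have hjI := hS hjS
        have hsub : T ∪ S₂ ⊆ S :=
          Finset.union_subset (hT'.trans (Finset.filter_subset _ _)) (Finset.filter_subset _ _)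
        have hss : T ∪ S₂ ⊂ S := by
          refine Finset.ssubset_iff_subset_ne.mpr ⟨hsub, fun h => ?_⟩
          rw [← h, Finset.mem_union] at hjS
          rcases hjS with h' | h'
          · exact hj h'
          · exact (Finset.mem_filter.mp h').2 (Finset.mem_filter.mp hjS₁).2
        have h1 := ih _ hss (hsub.trans hS) j hjI
        rw [Finset.prod_insert hj, Finset.insert_union, card_avoid_insert]
        have h2 := mul_le_mul_of_nonneg_left (ihT hT') (sub_nonneg.mpr (hx1 j hjI).le)
        linarith
    have h1 := key S₁ subset_rfl
    rw [Finset.filter_union_filter_not_eq] at h1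
    have h2 : ((avoid A S ∩ A i).card : ℝ) ≤ (avoid A S₂ ∩ A i).card := by
      exact_mod_cast Finset.card_le_card
        (Finset.inter_subset_inter_right (avoid_anti A (Finset.filter_subset _ _)))
    have h3 := hind i hi S₂ ((Finset.filter_subset _ _).trans hS)
      fun j hj => (Finset.mem_filter.mp hj).2
    have h4 : ∏ j ∈ I with adj i j, (1 - x j) ≤ ∏ j ∈ S₁, (1 - x j) := by
      have h0 : ∀ j ∈ I, 0 ≤ 1 - x j := fun j hj => sub_nonneg.mpr (hx1 j hj).le
      rw [← Finset.prod_sdiff (Finset.filter_subset_filter (fun j => adj i j) hS)]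
      refine mul_le_of_le_one_left (Finset.prod_nonneg fun j hj =>
        h0 j (hS (Finset.mem_filter.mp hj).1)) (Finset.prod_le_one ?_ ?_)
      · exact fun j hj => h0 j (Finset.mem_filter.mp (Finset.mem_sdiff.mp hj).1).1
      · exact fun j hj => by
          linarith [hx0 j (Finset.mem_filter.mp (Finset.mem_sdiff.mp hj).1).1]
    have h5 : (0 : ℝ) ≤ (avoid A S₂).card := Nat.cast_nonneg _
    calc ((avoid A S ∩ A i).card : ℝ) ≤ q i * (avoid A S₂).card := h2.trans h3
      _ ≤ x i * (∏ j ∈ S₁, (1 - x j)) * (avoid A S₂).card :=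
        mul_le_mul_of_nonneg_right
          ((hq i hi).trans (mul_le_mul_of_nonneg_left h4 (hx0 i hi))) h5
      _ = x i * ((∏ j ∈ S₁, (1 - x j)) * (avoid A S₂).card) := mul_assoc _ _ _
      _ ≤ _ := mul_le_mul_of_nonneg_left h1 (hx0 i hi)

/-- The asymmetric Lovász local lemma, for the uniform distribution on a finite type. -/
theorem lovasz_local_lemma [Nonempty Ω] (hx0 : ∀ i ∈ I, 0 ≤ x i) (hx1 : ∀ i ∈ I, x i < 1)
    (hind : ∀ i ∈ I, ∀ S ⊆ I, (∀ j ∈ S, ¬ adj i j) →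
      ((avoid A S ∩ A i).card : ℝ) ≤ q i * (avoid A S).card)
    (hq : ∀ i ∈ I, q i ≤ x i * ∏ j ∈ I with adj i j, (1 - x j)) :
    ∃ ω, ∀ i ∈ I, ω ∉ A i := by
  have key (S : Finset ι) (hS : S ⊆ I) : (0 : ℝ) < (avoid A S).card := by
    induction S using Finset.induction_on with
    | empty => simp [avoid, Fintype.card_pos]
    | insert j S hj ih =>
      have hjI := hS (Finset.mem_insert_self _ _)
      have hSI := (Finset.subset_insert j S).trans hS
      rw [card_avoid_insert]
      have h1 := card_avoid_inter_le hx0 hx1 hind hq S hSI j hjI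
      have h2 := mul_pos (sub_pos.mpr (hx1 j hjI)) (ih hSI)
      linarith
  have h := key I subset_rfl
  obtain ⟨ω, hω⟩ := Finset.card_pos.mp (Nat.cast_pos.mp h)
  exact ⟨ω, by simpa [avoid] using hω⟩

end LocalLemma

/-! ### Independence of disjoint sets of coordinates -/

section Independence

variable {α β : Type*} [DecidableEq α] [Fintype β] [DecidableEq β]

/-- The functions that map all of `E` into `X`. -/
def mapsInto [Fintype α] (E : Finset α) (X : Finset β) : Finset (α → β) :=
  Finset.univ.filter fun f => ∀ e ∈ E, f e ∈ X

/-- Exchanging `f e` with the extra value `b` is an involution on pairs `(f, b)`; it moves the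
condition from `f e` to `b`. -/
theorem card_filter_apply_mem (B : Finset (α → β)) (X : Finset β) (e : α)
    (hB : ∀ f b, f ∈ B → Function.update f e b ∈ B) :
    (B.filter fun f => f e ∈ X).card * Fintype.card β = B.card * X.card := by
  rw [← Finset.card_univ, ← Finset.card_product, ← Finset.card_product]
  refine Finset.card_nbij' (fun p => (Function.update p.1 e p.2, p.1 e))
    (fun p => (Function.update p.1 e p.2, p.1 e)) ?_ ?_ ?_ ?_
  · rintro ⟨f, b⟩ h
    simp only [Finset.coe_product, Set.mem_prod, Finset.mem_coe, Finset.mem_filter] at h ⊢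
    exact ⟨hB _ _ h.1.1, h.1.2⟩
  · rintro ⟨f, b⟩ h
    simp only [Finset.coe_product, Set.mem_prod, Finset.mem_coe, Finset.mem_filter] at h ⊢
    exact ⟨⟨hB _ _ h.1, by simpa using h.2⟩, Finset.mem_univ _⟩
  · rintro ⟨f, b⟩ _
    simp
  · rintro ⟨f, b⟩ _
    simp

theorem card_inter_mapsInto [Fintype α] (B : Finset (α → β)) (X : Finset β) (E : Finset α)
    (hB : ∀ f, ∀ e ∈ E, ∀ b, f ∈ B → Function.update f e b ∈ B) :
    (B ∩ mapsInto E X).card * Fintype.card β ^ E.card = B.card * X.card ^ E.card := by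
  induction E using Finset.induction_on with
  | empty => simp [mapsInto]
  | insert e E he ih =>
    have h1 : B ∩ mapsInto (insert e E) X = (B ∩ mapsInto E X).filter fun f => f e ∈ X := by
      ext f
      simp only [mapsInto, Finset.mem_inter, Finset.mem_filter, Finset.mem_univ, true_and,
        Finset.mem_insert, forall_eq_or_imp]
      tauto
    have h2 := card_filter_apply_mem (B ∩ mapsInto E X) X e (by
      intro f b hf
      simp only [mapsInto, Finset.mem_inter, Finset.mem_filter, Finset.mem_univ, true_and] at hf ⊢
      refine ⟨hB f e (Finset.mem_insert_self _ _) b hf.1, fun e' he' => ?_⟩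
      rw [Function.update_of_ne (by rintro rfl; exact he he')]
      exact hf.2 e' he')
    have h3 := ih fun f e' he' => hB f e' (Finset.mem_insert_of_mem he')
    rw [h1, Finset.card_insert_of_notMem he, pow_succ, pow_succ]
    calc _ = (((B ∩ mapsInto E X).filter fun f => f e ∈ X).card * Fintype.card β) *
          Fintype.card β ^ E.card := by ring
      _ = ((B ∩ mapsInto E X).card * Fintype.card β ^ E.card) * X.card := by rw [h2]; ring
      _ = _ := by rw [h3]; ring

theorem card_avoid_inter_mapsInto [Fintype α] [Nonempty β] {ι : Type*} (E : ι → Finset α)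
    (X : ι → Finset β)
    (i : ι) (S : Finset ι) (hS : ∀ j ∈ S, Disjoint (E i) (E j)) :
    ((avoid (fun j => mapsInto (E j) (X j)) S ∩ mapsInto (E i) (X i)).card : ℝ) =
      ((X i).card / Fintype.card β : ℝ) ^ (E i).card *
        (avoid (fun j => mapsInto (E j) (X j)) S).card := by
  have h := card_inter_mapsInto (avoid (fun j => mapsInto (E j) (X j)) S) (X i) (E i) (by
    intro f e he b hf
    simp only [avoid, mapsInto, Finset.mem_filter, Finset.mem_univ, true_and] at hf ⊢
    intro j hj h
    refine hf j hj fun e' he' => ?_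
    have := h e' he'
    rwa [Function.update_of_ne] at this
    rintro rfl
    exact Finset.disjoint_left.mp (hS j hj) he he')
  have hβ : (Fintype.card β : ℝ) ≠ 0 := by
    exact_mod_cast Fintype.card_ne_zero
  rw [div_pow, div_mul_eq_mul_div, eq_div_iff (pow_ne_zero _ hβ), mul_comm (_ ^ _)]
  exact_mod_cast h

end Independence

/-! ### Random graphs and the local lemma -/

section Edges

variable {V : Type*} [DecidableEq V]

/-- The unordered pairs of distinct elements of `K`. -/
def pairs (K : Finset V) : Finset (Sym2 V) := K.offDiag.image (Function.uncurry Sym2.mk)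

theorem mk_mem_pairs {K : Finset V} {a b : V} : s(a, b) ∈ pairs K ↔ a ∈ K ∧ b ∈ K ∧ a ≠ b := by
  simp only [pairs, Finset.mem_image, Finset.mem_offDiag, Prod.exists, Function.uncurry_apply_pair]
  constructor
  · rintro ⟨x, y, ⟨h1, h2, h3⟩, h⟩
    rcases Sym2.eq_iff.mp h with ⟨rfl, rfl⟩ | ⟨rfl, rfl⟩
    · exact ⟨h1, h2, h3⟩
    · exact ⟨h2, h1, h3.symm⟩
  · exact fun h => ⟨a, b, h, rfl⟩

theorem card_pairs (K : Finset V) : (pairs K).card = K.card.choose 2 :=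
  Sym2.card_image_offDiag K

theorem card_filter_mem_pairs_le [Fintype V] (l : ℕ) (e : Sym2 V) :
    ((Finset.univ.powersetCard l).filter fun K : Finset V => e ∈ pairs K).card ≤
      Fintype.card V ^ (l - 2) := by
  induction e using Sym2.ind with
  | _ a b =>
    calc _ ≤ ((Finset.univ : Finset V).powersetCard (l - 2)).card := by
          refine Finset.card_le_card_of_injOn (fun K => K \ {a, b}) ?_ ?_
          · intro K hK
            simp only [Finset.coe_filter, Finset.mem_powersetCard_univ, Set.mem_ofPred_eq,
              mk_mem_pairs, Finset.mem_coe] at hK ⊢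
            obtain ⟨hK, ha, hb, hab⟩ := hK
            rw [Finset.card_sdiff_of_subset (by simp [Finset.insert_subset_iff, ha, hb]),
              Finset.card_pair hab, hK]
          · intro K hK K' hK' h
            simp only [Finset.coe_filter, Set.mem_ofPred_eq, mk_mem_pairs] at hK hK'
            have h1 : ({a, b} : Finset V) ⊆ K := by simp [Finset.insert_subset_iff, hK.2]
            have h2 : ({a, b} : Finset V) ⊆ K' := by simp [Finset.insert_subset_iff, hK'.2]
            rw [← Finset.sdiff_union_of_subset h1, ← Finset.sdiff_union_of_subset h2]
            exact congrArg (· ∪ {a, b}) h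
      _ ≤ _ := by
          rw [Finset.card_powersetCard, Finset.card_univ]
          exact Nat.choose_le_pow _ _

theorem card_filter_not_disjoint_le [Fintype V] (l : ℕ) (F : Finset (Sym2 V)) :
    ((Finset.univ.powersetCard l).filter fun K : Finset V => ¬ Disjoint F (pairs K)).card ≤
      F.card * Fintype.card V ^ (l - 2) := by
  calc _ ≤ (F.biUnion fun e =>
        (Finset.univ.powersetCard l).filter fun K : Finset V => e ∈ pairs K).card := by
        refine Finset.card_le_card fun K hK => ?_
        obtain ⟨hK, h⟩ := Finset.mem_filter.mp hK
        obtain ⟨e, he, he'⟩ := Finset.not_disjoint_iff.mp h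
        exact Finset.mem_biUnion.mpr ⟨e, he, Finset.mem_filter.mpr ⟨hK, he'⟩⟩
    _ ≤ _ := Finset.card_biUnion_le_card_mul _ _ _ fun e _ => card_filter_mem_pairs_le l e

/-- The local lemma for `l`-cliques and independent `t`-sets of a random graph of density
`1 / N`. -/
theorem exists_graph_of_weights [Fintype V] {N l t : ℕ} (hN : 1 ≤ N) {x y : ℝ}
    (hx0 : 0 ≤ x) (hx1 : x < 1)
    (hy0 : 0 ≤ y) (hy1 : y < 1)
    (hcl : (1 / N : ℝ) ^ l.choose 2 ≤ x * ((1 - x) ^ (l.choose 2 * Fintype.card V ^ (l - 2)) *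
      (1 - y) ^ (Fintype.card V ^ t)))
    (hin : (1 - 1 / N : ℝ) ^ t.choose 2 ≤
      y * ((1 - x) ^ (t.choose 2 * Fintype.card V ^ (l - 2)) * (1 - y) ^ (Fintype.card V ^ t))) :
    ∃ H : SimpleGraph V, (∀ s, ¬ H.IsNClique l s) ∧ ∀ s, ¬ H.IsNIndepSet t s := by
  classical
  obtain ⟨N, rfl⟩ := Nat.exists_eq_add_of_le' hN
  let E : Finset V ⊕ Finset V → Finset (Sym2 V) := Sum.elim pairs pairs
  -- Each pair gets a uniform colour and colour `0` means edge, which realises the density in a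
  -- uniform finite space.
  let X : Finset V ⊕ Finset V → Finset (Fin (N + 1)) := Sum.elim (fun _ => {0}) fun _ => {0}ᶜ
  let I : Finset (Finset V ⊕ Finset V) :=
    (Finset.univ.powersetCard l).disjSum (Finset.univ.powersetCard t)
  let w : Finset V ⊕ Finset V → ℝ := Sum.elim (fun _ => x) fun _ => y
  have hw0 : ∀ i ∈ I, 0 ≤ w i := by rintro (i | i) _ <;> assumption
  have hw1 : ∀ i ∈ I, w i < 1 := by rintro (i | i) _ <;> assumption
  have hprod (F : Finset (Sym2 V)) :
      (1 - x) ^ (F.card * Fintype.card V ^ (l - 2)) * (1 - y) ^ (Fintype.card V ^ t) ≤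
        ∏ j ∈ I with ¬ Disjoint F (E j), (1 - w j) := by
    rw [Finset.prod_filter, Finset.prod_disjSum, ← Finset.prod_filter, ← Finset.prod_filter]
    simp only [w, E, Sum.elim_inl, Sum.elim_inr, Finset.prod_const]
    have hx2 : 0 ≤ 1 - x := by linarith
    have hy2 : 0 ≤ 1 - y := by linarith
    refine mul_le_mul ?_ ?_ (pow_nonneg hy2 _) (pow_nonneg hx2 _)
    · exact pow_le_pow_of_le_one hx2 (by linarith) (card_filter_not_disjoint_le l F)
    · refine pow_le_pow_of_le_one hy2 (by linarith) ((Finset.card_filter_le _ _).trans ?_)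
      rw [Finset.card_powersetCard, Finset.card_univ]
      exact Nat.choose_le_pow _ _
  obtain ⟨f, hf⟩ := lovasz_local_lemma (A := fun i => mapsInto (E i) (X i)) (x := w)
    (q := fun i => ((X i).card / Fintype.card (Fin (N + 1)) : ℝ) ^ (E i).card)
    (adj := fun i j => ¬ Disjoint (E i) (E j)) (I := I) hw0 hw1
    (fun i _ S _ h => (card_avoid_inter_mapsInto E X i S fun j hj => not_not.mp (h j hj)).le) (by
      rintro (K | K) hK
      · have hK : K.card = l := by simpa [I] using hK
        refine le_trans ?_ (mul_le_mul_of_nonneg_left (hprod _) (hw0 _ (by simpa [I] using hK)))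
        simpa [E, X, w, card_pairs, hK] using hcl
      · have hK : K.card = t := by simpa [I] using hK
        refine le_trans ?_ (mul_le_mul_of_nonneg_left (hprod _) (hw0 _ (by simpa [I] using hK)))
        have hN0 : (N + 1 : ℝ) ≠ 0 := by positivity
        have h1 : (1 - 1 / ((N + 1 : ℕ) : ℝ)) = N / (N + 1) := by
          push_cast
          field_simp
          ring
        rw [h1] at hin
        simpa [E, X, w, card_pairs, hK, Finset.card_compl] using hin)
  refine ⟨SimpleGraph.mk (fun a b => a ≠ b ∧ f s(a, b) = 0)
    ⟨fun a b h => ⟨h.1.symm, by rw [Sym2.eq_swap]; exact h.2⟩⟩ ⟨fun a h => h.1 rfl⟩, ?_, ?_⟩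
  · rintro s ⟨hs, hc⟩
    refine hf (Sum.inl s) (by simpa [I] using hc) ?_
    simp only [mapsInto, E, X, Sum.elim_inl, Finset.mem_filter, Finset.mem_univ, true_and,
      Finset.mem_singleton]
    intro e
    induction e using Sym2.ind with
    | _ a b =>
      intro h
      obtain ⟨ha, hb, hab⟩ := mk_mem_pairs.mp h
      exact (hs ha hb hab).2
  · rintro s ⟨hs, hc⟩
    refine hf (Sum.inr s) (by simpa [I] using hc) ?_
    simp only [mapsInto, E, X, Sum.elim_inr, Finset.mem_filter, Finset.mem_univ, true_and,
      Finset.mem_compl, Finset.mem_singleton]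
    intro e
    induction e using Sym2.ind with
    | _ a b =>
      intro h h0
      obtain ⟨ha, hb, hab⟩ := mk_mem_pairs.mp h
      exact hs ha hb hab ⟨hab, h0⟩

end Edges

/-! ### Choice of weights and Spencer's bound -/

theorem choose_two_mul_two (l : ℕ) : l.choose 2 * 2 = l * (l - 1) := by
  rw [Nat.choose_two_right, Nat.div_mul_cancel (Nat.even_mul_pred_self l).two_dvd]

/-- The exponent `2/(l+1)` comes from here: `l.choose 2 - 1 = (l + 1)(l - 2)/2`, so the hypothesis
is raised to the power `(l - 2)/2`. -/
theorem four_mul_pow_le {d l N : ℕ} (hl : 3 ≤ l) (hN : 16 * d ^ 2 ≤ N ^ (l + 1)) :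
    4 * d ^ (l - 2) * N ≤ N ^ l.choose 2 := by
  obtain ⟨a, rfl⟩ := Nat.exists_eq_add_of_le' hl
  have hm := choose_two_mul_two (a + 3)
  obtain ⟨b, hb⟩ : ∃ b, (a + 3).choose 2 = b + 1 :=
    Nat.exists_eq_add_of_le' (Nat.choose_pos (by omega))
  have hb2 : b * 2 = (a + 3 + 1) * (a + 1) := by
    simp only [hb, Nat.add_succ_sub_one] at hm
    linarith
  rw [hb, pow_succ, show a + 3 - 2 = a + 1 by omega]
  refine Nat.mul_le_mul_right _ ((Nat.pow_le_pow_iff_left two_ne_zero).mp ?_)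
  calc (4 * d ^ (a + 1)) ^ 2 = 16 ^ 1 * (d ^ 2) ^ (a + 1) := by ring
    _ ≤ 16 ^ (a + 1) * (d ^ 2) ^ (a + 1) :=
      Nat.mul_le_mul_right _ (Nat.pow_le_pow_right (by norm_num) (by omega))
    _ = (16 * d ^ 2) ^ (a + 1) := (mul_pow _ _ _).symm
    _ ≤ (N ^ (a + 3 + 1)) ^ (a + 1) := Nat.pow_le_pow_left hN _
    _ = (N ^ b) ^ 2 := by rw [← pow_mul, ← pow_mul, hb2]

/-- Since `1 - p ≤ (1 - p/2)^2`, one factor `(1 - p/2)^(t.choose 2)` can be spent: it is at most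
`d^(-2t)`, and `d^t ≥ 8`. -/
theorem one_sub_pow_le {p : ℝ} (hp : 0 < p) (hp1 : p ≤ 1) {d t : ℕ} (hd : 2 ≤ d) (ht3 : 3 ≤ t)
    (ht : 8 * Real.log d ≤ p * (t - 1)) :
    (1 - p) ^ t.choose 2 ≤ 1 / (8 * (d : ℝ) ^ t) * (1 - p / 2) ^ t.choose 2 := by
  have hd' : (2 : ℝ) ≤ d := by exact_mod_cast hd
  have ht' : (3 : ℝ) ≤ t := by exact_mod_cast ht3
  have h1 : (1 - p) ^ t.choose 2 ≤ (1 - p / 2) ^ t.choose 2 * (1 - p / 2) ^ t.choose 2 := by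
    rw [← mul_pow]
    exact pow_le_pow_left₀ (by linarith) (by nlinarith) _
  refine h1.trans (mul_le_mul_of_nonneg_right ?_ (pow_nonneg (by linarith) _))
  have h2 : (1 - p / 2) ^ t.choose 2 ≤ Real.exp (-(p / 2) * t.choose 2) := by
    rw [mul_comm, Real.exp_nat_mul]
    refine pow_le_pow_left₀ (by linarith) ?_ _
    linarith [Real.add_one_le_exp (-(p / 2))]
  refine h2.trans ?_
  have hpos : (0 : ℝ) < 8 * (d : ℝ) ^ t := by positivity
  rw [one_div, ← Real.exp_log hpos, ← Real.exp_neg, Real.exp_le_exp, neg_mul, neg_le_neg_iff,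
    Real.log_mul (by norm_num) (by positivity), Real.log_pow, Nat.cast_choose_two]
  have h8 : Real.log 8 = 3 * Real.log 2 := by
    rw [show (8 : ℝ) = 2 ^ 3 by norm_num, Real.log_pow]
    norm_num
  have h3 : Real.log 2 ≤ Real.log d := Real.log_le_log (by norm_num) hd'
  have h4 : 0 ≤ Real.log 2 := Real.log_nonneg (by norm_num)
  have h5 := mul_le_mul_of_nonneg_left ht (show (0 : ℝ) ≤ t by linarith)
  have h6 := mul_le_mul_of_nonneg_right ht' (h4.trans h3)
  rw [h8]
  nlinarith

/-- Spencer's lower bound for off-diagonal Ramsey numbers. -/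
theorem exists_graph_cliqueFree_indepFree {V : Type*} [Fintype V] [DecidableEq V] {l t N : ℕ}
    (hl : 3 ≤ l) (hV : 2 ≤ Fintype.card V) (hN : 2 * l.choose 2 ≤ N)
    (hN' : 16 * Fintype.card V ^ 2 ≤ N ^ (l + 1)) (ht3 : 3 ≤ t)
    (ht : 8 * N * Real.log (Fintype.card V) ≤ t - 1) :
    ∃ H : SimpleGraph V, (∀ s, ¬ H.IsNClique l s) ∧ ∀ s, ¬ H.IsNIndepSet t s := by
  set d := Fintype.card V
  set m := l.choose 2
  have hm : 1 ≤ m := Nat.choose_pos (by omega)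
  have hN1 : 1 ≤ N := by omega
  have hNr : (1 : ℝ) ≤ N := by exact_mod_cast hN1
  have hN0 : (0 : ℝ) < N := by linarith
  have hd : (2 : ℝ) ≤ d := by exact_mod_cast hV
  have hD : (1 : ℝ) ≤ (d : ℝ) ^ (l - 2) := one_le_pow₀ (by linarith)
  have hT : (1 : ℝ) ≤ (d : ℝ) ^ t := one_le_pow₀ (by linarith)
  have hp1 : 1 / (N : ℝ) ≤ 1 := by rwa [div_le_one hN0]
  have hx0 : (0 : ℝ) ≤ 2 / (N : ℝ) ^ m := by positivity
  have hxD : 2 / (N : ℝ) ^ m * (d : ℝ) ^ (l - 2) ≤ 1 / N / 2 := by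
    have h : 4 * (d : ℝ) ^ (l - 2) * N ≤ (N : ℝ) ^ m := by
      exact_mod_cast four_mul_pow_le hl hN'
    rw [div_mul_eq_mul_div, div_div, div_le_div_iff₀ (by positivity) (by positivity)]
    linarith
  have hx1 : 2 / (N : ℝ) ^ m ≤ 1 / 2 := by nlinarith
  have hy0 : (0 : ℝ) ≤ 1 / (4 * (d : ℝ) ^ t) := by positivity
  have hy1 : 1 / (4 * (d : ℝ) ^ t) ≤ 1 / 4 := by
    rw [div_le_div_iff₀ (by positivity) (by norm_num)]
    linarith
  have hy : 3 / 4 ≤ (1 - 1 / (4 * (d : ℝ) ^ t)) ^ (d ^ t) := by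
    have h := one_add_mul_le_pow (a := -(1 / (4 * (d : ℝ) ^ t))) (by linarith) (d ^ t)
    rw [← sub_eq_add_neg] at h
    refine le_trans (le_of_eq ?_) h
    push_cast
    field_simp
    norm_num
  have hx (n : ℕ) : 1 - n * (2 / (N : ℝ) ^ m) ≤ (1 - 2 / (N : ℝ) ^ m) ^ n := by
    have h := one_add_mul_le_pow (a := -(2 / (N : ℝ) ^ m)) (by linarith) n
    rw [← sub_eq_add_neg] at h
    linarith
  -- The weights are `x = 2 / N^m` and `y = 1 / (4 d^t)`. For cliques both products are at least
  -- `3/4`, and `2 * (3/4)^2 > 1`.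
  refine exists_graph_of_weights hN1 hx0 (by linarith) hy0 (by linarith) ?_ ?_
  · have h1 := hx (m * d ^ (l - 2))
    have h2 : (m : ℝ) * (2 / (N : ℝ) ^ m * (d : ℝ) ^ (l - 2)) ≤ 1 / 4 := by
      calc _ ≤ (m : ℝ) * (1 / N / 2) := mul_le_mul_of_nonneg_left hxD (Nat.cast_nonneg _)
        _ ≤ 1 / 4 := by
          have : 2 * (m : ℝ) ≤ N := by exact_mod_cast hN
          rw [div_div, mul_one_div, div_le_div_iff₀ (by positivity) (by norm_num)]
          linarith
    push_cast at h1
    have h3 : 3 / 4 ≤ (1 - 2 / (N : ℝ) ^ m) ^ (m * d ^ (l - 2)) := by linarith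
    have h4 := mul_le_mul h3 hy (by norm_num) (by linarith)
    have h5 := mul_le_mul_of_nonneg_left h4 hx0
    refine le_trans ?_ h5
    rw [div_pow, one_pow, div_mul_eq_mul_div]
    exact div_le_div_of_nonneg_right (by norm_num) (by positivity)
  · have h1 : 1 - 1 / (N : ℝ) / 2 ≤ (1 - 2 / (N : ℝ) ^ m) ^ (d ^ (l - 2)) := by
      have := hx (d ^ (l - 2))
      push_cast at this
      linarith
    have h2 : (1 - 1 / (N : ℝ) / 2) ^ t.choose 2 ≤
        (1 - 2 / (N : ℝ) ^ m) ^ (t.choose 2 * d ^ (l - 2)) := by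
      rw [mul_comm, pow_mul]
      exact pow_le_pow_left₀ (by linarith) h1 _
    have h3 := one_sub_pow_le (p := 1 / (N : ℝ)) (by positivity) hp1 hV ht3 (by
      rw [one_div_mul_eq_div, le_div_iff₀ hN0]
      linarith)
    refine h3.trans ?_
    have h4 : 0 ≤ (1 - 1 / (N : ℝ) / 2) ^ t.choose 2 := pow_nonneg (by linarith) _
    have h5 := mul_le_mul h2 hy (by norm_num) (h4.trans h2)
    have h6 := mul_le_mul_of_nonneg_left h5 hy0
    refine le_trans ?_ h6
    have h7 : 1 / (8 * (d : ℝ) ^ t) = 1 / (4 * (d : ℝ) ^ t) / 2 := by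
      rw [div_div]
      ring
    rw [h7]
    nlinarith [mul_nonneg hy0 h4]

/-! ### From Ramsey graphs to subcubes -/

/-- Subcubes indexed by the vertices of `H`, two of which are disjoint iff the vertices are
adjacent. -/
noncomputable def graphCode {d : ℕ} (H : SimpleGraph (Fin d)) (w : Fin d) : SubcubeCode d :=
  open Classical in
  fun v => if w = v then some false else if w < v ∧ H.Adj w v then some true else none

theorem graphCode_disjoint {d : ℕ} {H : SimpleGraph (Fin d)} {v w : Fin d} (h : H.Adj v w) :
    ¬ ((graphCode H v).points ∩ (graphCode H w).points).Nonempty := by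
  have key {v w : Fin d} (h : H.Adj v w) (hlt : v < w) :
      ¬ ((graphCode H v).points ∩ (graphCode H w).points).Nonempty :=
    points_inter_eq_empty (i := w) (b := true) (by simp [graphCode, h.ne, hlt, h])
      (by simp [graphCode])
  rcases lt_or_gt_of_ne h.ne with hlt | hlt
  · exact key h hlt
  · rw [Set.inter_comm]
    exact key h.symm hlt

theorem graphCode_inter {d : ℕ} {H : SimpleGraph (Fin d)} {v w : Fin d} (h : ¬ H.Adj v w) :
    ((graphCode H v).points ∩ (graphCode H w).points).Nonempty := by
  have h' : ¬ H.Adj w v := fun h' => h h'.symm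
  -- A code has `false` only at its own vertex, so `false` at `v`, `w` and `true` elsewhere works.
  refine ⟨fun i => decide (i ≠ v ∧ i ≠ w), mem_points_of_forall_ne _ _ fun i => ?_,
    mem_points_of_forall_ne _ _ fun i => ?_⟩
  all_goals
    by_cases h1 : i = v
    · subst h1
      simp [graphCode, h']
    · by_cases h2 : i = w
      · subst h2
        simp [graphCode, h]
      · simp [graphCode, h1, h2, Ne.symm h1, Ne.symm h2]

theorem lt_subcubeRamsey {n d k l : ℕ} (A : Fin n → SubcubeCode d)
    (hk : ∀ s, ¬ (subcubeIntersectionGraph A).IsNClique k s)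
    (hl : ∀ s, ¬ (subcubeIntersectionGraph A).IsNIndepSet l s) : n < subcubeRamsey d k l := by
  by_contra! h
  have hmem := (isLeast_subcubeRamsey d k l).1
  rcases hmem _ ⟨A ∘ Fin.castLE h, rfl⟩ with ⟨s, hs, hc⟩ | ⟨s, hs, hc⟩
  · refine hk (s.map (Fin.castLEEmb h)) ⟨?_, by rw [Finset.card_map, hc]⟩
    intro i hi j hj hij
    obtain ⟨i, hi', rfl⟩ := Finset.mem_map.mp hi
    obtain ⟨j, hj', rfl⟩ := Finset.mem_map.mp hj
    exact ⟨hij, (hs hi' hj' fun h => hij (by rw [h])).2⟩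
  · refine hl (s.map (Fin.castLEEmb h)) ⟨?_, by rw [Finset.card_map, hc]⟩
    intro i hi j hj hij
    obtain ⟨i, hi', rfl⟩ := Finset.mem_map.mp hi
    obtain ⟨j, hj', rfl⟩ := Finset.mem_map.mp hj
    have hne : i ≠ j := fun h => hij (by rw [h])
    exact fun hadj => hs hi' hj' hne ⟨hne, hadj.2⟩

theorem mul_lt_subcubeRamsey_of_graph {d l t q k : ℕ} (H : SimpleGraph (Fin d))
    (hcl : ∀ s, ¬ H.IsNClique l s) (hin : ∀ s, ¬ H.IsNIndepSet t s) (hk : 1 ≤ k)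
    (htq : t * q ≤ k) : d * q < subcubeRamsey d k l := by
  classical
  let π : Fin (d * q) → Fin d := fun j => (finProdFinEquiv.symm j).1
  refine lt_subcubeRamsey (fun j => graphCode H (π j)) ?_ ?_
  · rintro s ⟨hs, hc⟩
    have h1 : (s.image π).card < t := by
      by_contra! h
      obtain ⟨u, hu, hut⟩ := Finset.exists_subset_card_eq h
      refine hin u ⟨?_, hut⟩
      intro v hv w hw hvw hadj
      obtain ⟨i, hi, rfl⟩ := Finset.mem_image.mp (hu hv)
      obtain ⟨j, hj, rfl⟩ := Finset.mem_image.mp (hu hw)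
      exact graphCode_disjoint hadj (hs hi hj fun h => hvw (by rw [h])).2
    have h2 : s.card ≤ q * (s.image π).card := by
      refine Finset.card_le_mul_card_image s q fun v _ => ?_
      calc _ ≤ (Finset.univ : Finset (Fin q)).card := by
            refine Finset.card_le_card_of_injOn (fun j => (finProdFinEquiv.symm j).2)
              (fun _ _ => Finset.mem_coe.mpr (Finset.mem_univ _)) ?_
            intro i hi j hj hij
            have hi := (Finset.mem_filter.mp hi).2
            have hj := (Finset.mem_filter.mp hj).2
            exact finProdFinEquiv.symm.injective (Prod.ext (hi.trans hj.symm) hij)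
        _ = q := by simp
    rcases Nat.eq_zero_or_pos q with rfl | hq
    · omega
    · have := Nat.mul_lt_mul_of_pos_left h1 hq
      rw [mul_comm t] at htq
      omega
  · rintro s ⟨hs, hc⟩
    -- This also covers `π i = π j`: copies of one subcube meet, so `π` is injective on `s`.
    have hne {i j} (hi : i ∈ s) (hj : j ∈ s) (hij : i ≠ j) : H.Adj (π i) (π j) := by
      by_contra h
      exact hs hi hj hij ⟨hij, graphCode_inter h⟩
    refine hcl (s.image π) ⟨?_, ?_⟩
    · intro v hv w hw hvw
      obtain ⟨i, hi, rfl⟩ := Finset.mem_image.mp hv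
      obtain ⟨j, hj, rfl⟩ := Finset.mem_image.mp hw
      exact hne hi hj fun h => hvw (by rw [h])
    · rw [Finset.card_image_of_injOn, hc]
      intro i hi j hj hij
      by_contra h
      exact (hne hi hj h).ne hij

theorem subcubeRamsey_lower {l : ℕ} (hl : 3 ≤ l) : ∃ c : ℝ, 0 < c ∧ ∀ d k : ℕ, 2 ≤ d → 1 ≤ k →
    d * ⌊(k : ℝ) / (c * (d : ℝ) ^ ((2 : ℝ) / ((l : ℝ) + 1)) * Real.logb 2 (d : ℝ))⌋₊
      < subcubeRamsey d k l := by
  set m := l.choose 2 with hm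
  have hm3 : 3 ≤ m := Nat.choose_le_choose 2 hl
  have hmr : (3 : ℝ) ≤ m := by exact_mod_cast hm3
  -- `N ≤ 2m(4D + 1) ≤ 10mD` and `t ≤ 8N log d + 2 ≤ 10N log d` together give `100 * m`.
  refine ⟨100 * m, by linarith, fun d k hd hk => ?_⟩
  have hdr : (2 : ℝ) ≤ d := by exact_mod_cast hd
  set D : ℝ := (d : ℝ) ^ ((2 : ℝ) / ((l : ℝ) + 1)) with hD
  have hD1 : 1 ≤ D := Real.one_le_rpow (by linarith) (by positivity)
  have hDl : D ^ (l + 1) = (d : ℝ) ^ 2 := by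
    rw [hD, ← Real.rpow_natCast, ← Real.rpow_mul (by linarith)]
    push_cast
    rw [div_mul_cancel₀ _ (by positivity)]
    norm_cast
  set N := 2 * m * ⌈4 * D⌉₊ with hNdef
  have hceil : 4 * D ≤ ⌈4 * D⌉₊ := Nat.le_ceil _
  have hceil' : (⌈4 * D⌉₊ : ℝ) < 4 * D + 1 := Nat.ceil_lt_add_one (by linarith)
  have hNcast : (N : ℝ) = 2 * m * ⌈4 * D⌉₊ := by
    rw [hNdef]
    push_cast
    rfl
  have hNlow : 4 * D ≤ N := by nlinarith
  have hNup : (N : ℝ) ≤ 10 * m * D := by nlinarith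
  have hN2 : 2 * m ≤ N := Nat.le_mul_of_pos_right _ (Nat.ceil_pos.mpr (by linarith))
  have hN16 : 16 * d ^ 2 ≤ N ^ (l + 1) := by
    have h1 : (16 : ℝ) ≤ 4 ^ (l + 1) := by
      calc (16 : ℝ) = 4 ^ 2 := by norm_num
        _ ≤ 4 ^ (l + 1) := pow_le_pow_right₀ (by norm_num) (by omega)
    have h2 : 16 * (d : ℝ) ^ 2 ≤ (N : ℝ) ^ (l + 1) := by
      calc 16 * (d : ℝ) ^ 2 ≤ 4 ^ (l + 1) * (d : ℝ) ^ 2 :=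
            mul_le_mul_of_nonneg_right h1 (by positivity)
        _ = (4 * D) ^ (l + 1) := by rw [mul_pow, hDl]
        _ ≤ _ := pow_le_pow_left₀ (by linarith) hNlow _
    exact_mod_cast h2
  have hlog2 := Real.log_two_gt_d9
  have hlog2' := Real.log_two_lt_d9
  have hlog : Real.log 2 ≤ Real.log d := Real.log_le_log (by norm_num) hdr
  have hlogb : Real.log d ≤ Real.logb 2 d := by
    rw [Real.logb, le_div_iff₀ (by linarith)]
    nlinarith
  have hNlog : 1 ≤ N * Real.log d := by nlinarith
  set t := ⌈8 * N * Real.log d⌉₊ + 1 with ht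
  have ht1 : 8 * N * Real.log d ≤ ⌈8 * N * Real.log d⌉₊ := Nat.le_ceil _
  have ht2 : (⌈8 * N * Real.log d⌉₊ : ℝ) < 8 * N * Real.log d + 1 :=
    Nat.ceil_lt_add_one (by linarith)
  have htcast : (t : ℝ) = ⌈8 * N * Real.log d⌉₊ + 1 := by
    rw [ht]
    push_cast
    rfl
  have ht3 : 3 ≤ t := by
    have : (3 : ℝ) ≤ t := by linarith
    exact_mod_cast this
  obtain ⟨H, hcl, hin⟩ := exists_graph_cliqueFree_indepFree (V := Fin d) (l := l) (t := t)
    (N := N) hl (by simpa using hd) hN2 (by simpa using hN16) ht3 (by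
      rw [Fintype.card_fin]
      linarith)
  refine mul_lt_subcubeRamsey_of_graph H hcl hin hk ?_
  set q := ⌊(k : ℝ) / (100 * m * D * Real.logb 2 d)⌋₊ with hq
  have hpos : 0 < 100 * m * D * Real.logb 2 d := by
    have : 0 < Real.logb 2 d := by linarith
    positivity
  have htD : (t : ℝ) ≤ 100 * m * D * Real.logb 2 d := by
    calc (t : ℝ) ≤ 10 * (N * Real.log d) := by linarith
      _ ≤ 10 * ((10 * m * D) * Real.logb 2 d) := by
        refine mul_le_mul_of_nonneg_left ?_ (by norm_num)
        exact mul_le_mul hNup hlogb (by linarith) (by positivity)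
      _ = _ := by ring
  have hqk : (q : ℝ) * (100 * m * D * Real.logb 2 d) ≤ k := by
    rw [← le_div_iff₀ hpos]
    exact Nat.floor_le (by positivity)
  have : (t : ℝ) * q ≤ k := by
    calc (t : ℝ) * q ≤ (100 * m * D * Real.logb 2 d) * q :=
          mul_le_mul_of_nonneg_right htD (Nat.cast_nonneg _)
      _ ≤ k := by linarith
  exact_mod_cast this

theorem mainTheorem3 :
    (∀ l : ℕ, 3 ≤ l → ∃ c : ℝ, 0 < c ∧ ∀ d k : ℕ, 2 ≤ d → 1 ≤ k →
      d * ⌊(k : ℝ) / (c * (d : ℝ) ^ ((2 : ℝ) / ((l : ℝ) + 1)) * Real.logb 2 (d : ℝ))⌋₊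
        < subcubeRamsey d k l) ∧
    (∀ l d k : ℕ, 2 ≤ l → 1 ≤ d → 1 ≤ k →
      subcubeRamsey d k l < 2 * d ^ (l - 2) * k) :=
  ⟨fun _ hl => subcubeRamsey_lower hl, fun _ _ _ hl hd hk => subcubeRamsey_upper hl hd hk⟩
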